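/- Let $B$ be a Wiener process on $[-1,2]$ (started at $B_{-1}=0$), let $L>0$, let $f:[-1,2]\to\mathbb R$ be $L$-Lipschitz, and let $Z_t=\int_{-1}^t f(s)\,ds+B_t$ for $t\in[-1,2]$. Let $\eta\in(0,1]$ and $\alpha\in(0,1)$, and put $$Y_t=(2\eta)^{-1/2}\bigl(Z_{t+\eta}-Z_{t-\eta}-L\eta^2\bigr),\qquad t\in[0,1].$$ Let $\Lambda$ be Lebesgue measure on $[0,1]$ and $\overline\Phi(w)=\mathbb P(W\ge w)$ with $W$ standard Gaussian. Define $$\hat r=\max\Bigl\{r\in[0,1] : \Lambda\bigl(\{t\in[0,1] : \overline\Phi(Y_t)\le\alpha r\}\bigr)\ge r\Bigr\},$$ where the maximum is attained. Then the linear step-up procedure, which rejects the null hypotheses "$f(t)\le 0$" for those $t\in[0,1]$ with $\overline\Phi(Y_t)\le\alpha\hat r$, has false discovery rate at most $\alpha$: $$\mathbb E\left[\frac{\Lambda\bigl(\{t\in[0,1] : f(t)\le 0,\ \overline\Phi(Y_t)\le\alpha\hat r\}\bigr)}{\Lambda\bigl(\{t\in[0,1] : \overline\Phi(Y_t)\le\alpha\hat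 r\}\bigr)}\right]\le\alpha,$$ where the ratio is read as $0$ when its denominator is $0$, and it is an integrable random variable. -/

import Mathlib

open MeasureTheory ProbabilityTheory Set

/-- `B` is a (standard) Wiener process on the interval `[a, b]`: it starts at `0` at the left
endpoint, has independent increments, its increment from `s` to `t` (`a ≤ s ≤ t ≤ b`) is
`N(0, t - s)`-distributed, and almost all of its paths are continuous on `[a, b]`.
Values of `B` at times outside `[a, b]` are irrelevant. -/
structure IsWienerProcessOn {Ω : Type*} [MeasurableSpace Ω] (a b : ℝ) (B : ℝ → Ω → ℝ)
    (P : Measure Ω) : Prop where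
  start_eq_zero : ∀ᵐ ω ∂P, B a ω = 0
  indep_increments : HasIndepIncrements (fun t : Icc a b => B t) P
  law_increment : ∀ s t : ℝ, a ≤ s → s ≤ t → t ≤ b →
    HasLaw (fun ω => B t ω - B s ω) (gaussianReal 0 (t - s).toNNReal) P
  continuous_paths : ∀ᵐ ω ∂P, ContinuousOn (fun t => B t ω) (Icc a b)

/-- The observed process `Z_t = ∫_{-1}^t f(s) ds + B_t` for `t ∈ [-1, 2]`. -/
noncomputable def signalPlusNoise {Ω : Type*} (f : ℝ → ℝ) (B : ℝ → Ω → ℝ) (t : ℝ) (ω : Ω) : ℝ :=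
  (∫ s in (-1 : ℝ)..t, f s) + B t ω

/-- The test statistic `Y_t = (2η)^{-1/2} (Z_{t+η} - Z_{t-η} - L η²)` built from a process `Z`. -/
noncomputable def testStatistic {Ω : Type*} (L η : ℝ) (Z : ℝ → Ω → ℝ) (t : ℝ) (ω : Ω) : ℝ :=
  (Real.sqrt (2 * η))⁻¹ * (Z (t + η) ω - Z (t - η) ω - L * η ^ 2)

/-- Upper tail `w ↦ ℙ(W ≥ w)` of a standard Gaussian variable `W`. -/
noncomputable def gaussianUpperTail (w : ℝ) : ℝ :=
  (gaussianReal 0 1).real (Ici w)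

/-- The hypotheses `t ∈ [0, 1]` whose p-value `p t` is at most `α r`. -/
def pValueLevelSet (α : ℝ) (p : ℝ → ℝ) (r : ℝ) : Set ℝ :=
  {t | t ∈ Icc (0 : ℝ) 1 ∧ p t ≤ α * r}

/-- The values `r ∈ [0, 1]` such that the level set at `α r` has Lebesgue measure at least `r`. -/
noncomputable def stepUpCandidates (α : ℝ) (p : ℝ → ℝ) : Set ℝ :=
  {r | r ∈ Icc (0 : ℝ) 1 ∧ r ≤ volume.real (pValueLevelSet α p r)}

/-- The rejection volume `r̂` of the linear step-up procedure: the largest candidate. -/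
noncomputable def stepUpVolume (α : ℝ) (p : ℝ → ℝ) : ℝ :=
  sSup (stepUpCandidates α p)

/-- The rejection set of the linear step-up procedure on `[0, 1]`. -/
noncomputable def linearStepUp (α : ℝ) (p : ℝ → ℝ) : Set ℝ :=
  pValueLevelSet α p (stepUpVolume α p)

/-- False discovery proportion of a rejection set `R ⊆ [0, 1]` when the true nulls are those `t`
with `f t ≤ 0`; it is `0` when `R` has measure zero. -/
noncomputable def falseDiscoveryProportion (f : ℝ → ℝ) (R : Set ℝ) : ℝ :=
  if 0 < volume.real R then volume.real {t | t ∈ R ∧ f t ≤ 0} / volume.real R else 0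

/-!
The false discovery proportion is the integral over the true nulls `t` of `𝟙{p_t ≤ α r̂} / r̂`
(`ofReal_falseDiscoveryProportion_linearStepUp`, which uses that the rejection set has volume
exactly `r̂`). By Tonelli it is enough to bound the expectation of each integrand by `α`.

Fix a true null `t`. The test statistic is `Y_s = m_s + ξ_s`, where `ξ` is the normalised increment
of the Wiener process over the window around `s`. The Lipschitz bound and the correction `L η²`
give `m_t ≤ 0` (`windowMean_nonpos`), so `p_t` is stochastically at least uniform. The covariance
`c_s` of `ξ_s` and `ξ_t` is the relative overlap of the two windows, hence nonnegative, and
`W_s = ξ_s - c_s ξ_t` is a Gaussian process uncorrelated with, hence independent of, `ξ_t`.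
Conditionally on `W`, all statistics `Y_s = m_s + c_s ξ_t + W_s` increase with `ξ_t`; therefore
`p_t` is an antitone function of `ξ_t`, while `r̂` is a monotone one. For such functions
`𝔼[𝟙{p_t ≤ α r̂} / r̂] ≤ α`: whenever `p_t ≤ α r̂` holds, `α r̂` is at least the supremum `u` of `p_t`
over this event, and the event has probability at most `u`
(`lintegral_indicator_ofReal_inv_le`). This is carried out in
`lintegral_rejection_le_of_decomposition` and `lintegral_falseDiscoveryProportion_le`.

On the measure-theoretic side, `ξ` is replaced by an almost surely equal process whose paths are all
continuous and whose marginals are measurable, hence jointly measurable. Measurability of `r̂` comes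
from the right-continuity in `r` of the volume of the level sets (`le_stepUpVolume_iff`).
-/

/-! ### The step-up volume of a fixed p-value function -/

lemma pValueLevelSet_subset (α : ℝ) (p : ℝ → ℝ) (r : ℝ) : pValueLevelSet α p r ⊆ Icc 0 1 :=
  fun _ ht => ht.1

lemma volume_pValueLevelSet_ne_top (α : ℝ) (p : ℝ → ℝ) (r : ℝ) :
    volume (pValueLevelSet α p r) ≠ ⊤ :=
  measure_ne_top_of_subset (pValueLevelSet_subset α p r) (by simp)

lemma volume_real_pValueLevelSet_le_one (α : ℝ) (p : ℝ → ℝ) (r : ℝ) :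
    volume.real (pValueLevelSet α p r) ≤ 1 :=
  (measureReal_mono (pValueLevelSet_subset α p r) (by simp)).trans (by simp)

lemma pValueLevelSet_mono {α : ℝ} (hα : 0 ≤ α) {p p' : ℝ → ℝ}
    (hp : ∀ t ∈ Icc (0 : ℝ) 1, p' t ≤ p t) {r r' : ℝ} (hr : r ≤ r') :
    pValueLevelSet α p r ⊆ pValueLevelSet α p' r' := fun t ht =>
  ⟨ht.1, (hp t ht.1).trans (ht.2.trans (mul_le_mul_of_nonneg_left hr hα))⟩

lemma volume_real_pValueLevelSet_mono {α : ℝ} (hα : 0 ≤ α) {p p' : ℝ → ℝ}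
    (hp : ∀ t ∈ Icc (0 : ℝ) 1, p' t ≤ p t) {r r' : ℝ} (hr : r ≤ r') :
    volume.real (pValueLevelSet α p r) ≤ volume.real (pValueLevelSet α p' r') :=
  measureReal_mono (pValueLevelSet_mono hα hp hr) (volume_pValueLevelSet_ne_top _ _ _)

lemma bddAbove_stepUpCandidates (α : ℝ) (p : ℝ → ℝ) : BddAbove (stepUpCandidates α p) :=
  ⟨1, fun _ hr => hr.1.2⟩

lemma zero_mem_stepUpCandidates (α : ℝ) (p : ℝ → ℝ) : 0 ∈ stepUpCandidates α p :=
  ⟨by simp, measureReal_nonneg⟩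

/-- The maximum defining the rejection volume is attained for every p-value function, measurable
or not: level sets grow with `r`, so the supremum of the candidates is again a candidate. -/
lemma isGreatest_stepUpVolume {α : ℝ} (hα : 0 ≤ α) (p : ℝ → ℝ) :
    IsGreatest (stepUpCandidates α p) (stepUpVolume α p) := by
  have hne : (stepUpCandidates α p).Nonempty := ⟨0, zero_mem_stepUpCandidates α p⟩
  have hbdd := bddAbove_stepUpCandidates α p
  refine ⟨⟨⟨le_csSup hbdd (zero_mem_stepUpCandidates α p), csSup_le hne fun r hr => hr.1.2⟩,
    csSup_le hne fun r hr => hr.2.trans ?_⟩, fun r hr => le_csSup hbdd hr⟩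
  exact volume_real_pValueLevelSet_mono hα (fun _ _ => le_rfl) (le_csSup hbdd hr)

lemma stepUpVolume_nonneg {α : ℝ} (hα : 0 ≤ α) (p : ℝ → ℝ) : 0 ≤ stepUpVolume α p :=
  (isGreatest_stepUpVolume hα p).1.1.1

/-- The rejection set has volume exactly `r̂`: were it larger, its volume would be a candidate
exceeding the largest one. -/
lemma volume_real_linearStepUp {α : ℝ} (hα : 0 ≤ α) (p : ℝ → ℝ) :
    volume.real (linearStepUp α p) = stepUpVolume α p := by
  obtain ⟨hmem, hub⟩ := isGreatest_stepUpVolume hα p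
  refine le_antisymm (hub ⟨⟨measureReal_nonneg, volume_real_pValueLevelSet_le_one _ _ _⟩, ?_⟩)
    hmem.2
  exact volume_real_pValueLevelSet_mono hα (fun _ _ => le_rfl) hmem.2

lemma stepUpVolume_anti {α : ℝ} (hα : 0 ≤ α) {p p' : ℝ → ℝ}
    (hp : ∀ t ∈ Icc (0 : ℝ) 1, p' t ≤ p t) : stepUpVolume α p ≤ stepUpVolume α p' := by
  obtain ⟨hmem, -⟩ := isGreatest_stepUpVolume hα p
  exact (isGreatest_stepUpVolume hα p').2
    ⟨hmem.1, hmem.2.trans (volume_real_pValueLevelSet_mono hα hp le_rfl)⟩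

lemma linearStepUp_congr {α : ℝ} {p p' : ℝ → ℝ} (hp : EqOn p p' (Icc 0 1)) :
    linearStepUp α p = linearStepUp α p' := by
  have h : pValueLevelSet α p = pValueLevelSet α p' := by
    ext r t
    exact and_congr_right fun ht => by rw [hp ht]
  simp only [linearStepUp, stepUpVolume, stepUpCandidates, h]

open Filter Topology in
/-- Right-continuity of the volume of level sets, in the form of a closure property: if the
volumes just above `r` are at least `v`, then so is the volume at `r`. -/
lemma le_volume_real_pValueLevelSet_of_forall_gt {α : ℝ} (hα : 0 < α) {p : ℝ → ℝ}
    (hmeas : ∀ r, MeasurableSet (pValueLevelSet α p r)) {r v : ℝ}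
    (h : ∀ r' > r, v ≤ volume.real (pValueLevelSet α p r')) :
    v ≤ volume.real (pValueLevelSet α p r) := by
  have key : Tendsto (volume ∘ pValueLevelSet α p) (𝓝[>] r)
      (𝓝 (volume (⋂ r' > r, pValueLevelSet α p r'))) :=
    tendsto_measure_biInter_gt (fun r' _ => (hmeas r').nullMeasurableSet)
      (fun i j _ hij => pValueLevelSet_mono hα.le (fun _ _ => le_rfl) hij)
      ⟨r + 1, by simp, volume_pValueLevelSet_ne_top _ _ _⟩
  have hinter : ⋂ r' > r, pValueLevelSet α p r' = pValueLevelSet α p r := by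
    ext t
    simp only [mem_iInter]
    refine ⟨fun ht => ⟨(ht (r + 1) (by simp)).1, ?_⟩,
      fun ht r' hr' => pValueLevelSet_mono hα.le (fun _ _ => le_rfl) hr'.le ht⟩
    have hdiv : p t / α ≤ r := le_of_forall_gt_imp_ge_of_dense fun r' hr' => by
      rw [div_le_iff₀' hα]
      exact (ht r' hr').2
    rwa [div_le_iff₀' hα] at hdiv
  rw [hinter] at key
  have key' : Tendsto (fun r' => volume.real (pValueLevelSet α p r')) (𝓝[>] r)
      (𝓝 (volume.real (pValueLevelSet α p r))) :=
    (ENNReal.tendsto_toReal (volume_pValueLevelSet_ne_top _ _ _)).comp key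
  exact ge_of_tendsto key' (eventually_nhdsWithin_of_forall h)

open Filter Topology in
/-- The step-up volume is at least `c` exactly when, up to arbitrarily small errors, there are
rational candidates above `c`; this reduces its measurability to that of countably many
volumes of level sets. -/
lemma le_stepUpVolume_iff {α : ℝ} (hα : 0 < α) {p : ℝ → ℝ} {c : ℝ} (hc : 0 ≤ c)
    (hmeas : ∀ r, MeasurableSet (pValueLevelSet α p r)) :
    c ≤ stepUpVolume α p ↔ ∀ n : ℕ, ∃ q : ℚ, c ≤ q ∧
      q - 1 / (n + 1 : ℝ) ≤ volume.real (pValueLevelSet α p q) := by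
  have hgreat := isGreatest_stepUpVolume hα.le p
  constructor
  · intro h n
    obtain ⟨q, hq1, hq2⟩ := exists_rat_btwn (lt_add_of_pos_right (stepUpVolume α p)
      (Nat.one_div_pos_of_nat (n := n) (α := ℝ)))
    refine ⟨q, h.trans hq1.le, ?_⟩
    have := volume_real_pValueLevelSet_mono hα.le (p := p) (fun _ _ => le_rfl) hq1.le
    linarith [hgreat.1.2]
  · intro h
    choose q hcq hq using h
    have hq2 : ∀ n, (q n : ℝ) ∈ Icc c 2 := fun n => by
      refine ⟨hcq n, ?_⟩
      have h1 : 1 / ((n : ℝ) + 1) ≤ 1 := by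
        rw [div_le_one (by positivity)]
        linarith [n.cast_nonneg (α := ℝ)]
      linarith [hq n, volume_real_pValueLevelSet_le_one α p (q n)]
    obtain ⟨x, hx, φ, hφ, hlim⟩ := isCompact_Icc.tendsto_subseq hq2
    have herr : Tendsto (fun n => 1 / ((φ n : ℝ) + 1)) atTop (𝓝 0) :=
      tendsto_one_div_add_atTop_nhds_zero_nat.comp hφ.tendsto_atTop
    have hlim' : Tendsto (fun n => (q (φ n) : ℝ) - 1 / ((φ n : ℝ) + 1)) atTop (𝓝 x) := by
      simpa using! hlim.sub herr
    have hxvol : x ≤ volume.real (pValueLevelSet α p x) := by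
      refine le_volume_real_pValueLevelSet_of_forall_gt hα hmeas fun r' hr' => ?_
      refine le_of_tendsto hlim' ?_
      filter_upwards [hlim.eventually_lt_const hr'] with n hn
      exact (hq _).trans (volume_real_pValueLevelSet_mono hα.le (fun _ _ => le_rfl) hn.le)
    exact hx.1.trans (hgreat.2
      ⟨⟨hc.trans hx.1, hxvol.trans (volume_real_pValueLevelSet_le_one α p x)⟩, hxvol⟩)

/-! ### Measurability of the procedure -/

section Measurability

variable {S : Type*} [MeasurableSpace S] {α : ℝ} {p : S → ℝ → ℝ}

lemma measurableSet_pValueLevelSet_uncurry (hp : Measurable (Function.uncurry p)) {r : S → ℝ}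
    (hr : Measurable r) : MeasurableSet {x : S × ℝ | x.2 ∈ pValueLevelSet α (p x.1) (r x.1)} :=
  (measurable_snd measurableSet_Icc).inter
    (measurableSet_le hp ((hr.comp measurable_fst).const_mul α))

lemma measurableSet_pValueLevelSet (hp : Measurable (Function.uncurry p)) (s : S) (r : ℝ) :
    MeasurableSet (pValueLevelSet α (p s) r) :=
  measurable_prodMk_left (x := s)
    (measurableSet_pValueLevelSet_uncurry (α := α) hp (measurable_const (a := r)))

lemma measurable_stepUpVolume (hα : 0 < α) (hp : Measurable (Function.uncurry p)) :
    Measurable fun s => stepUpVolume α (p s) := by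
  refine measurable_of_Ici fun c => ?_
  rcases le_total c 0 with hc | hc
  · convert! MeasurableSet.univ
    exact eq_univ_of_forall fun s => hc.trans (stepUpVolume_nonneg hα.le _)
  have hset : (fun s => stepUpVolume α (p s)) ⁻¹' Ici c = ⋂ n : ℕ, ⋃ q : ℚ,
      {_s | c ≤ q} ∩ {s | q - 1 / (n + 1 : ℝ) ≤ volume.real (pValueLevelSet α (p s) q)} := by
    ext s
    simp only [mem_preimage, mem_Ici, mem_iInter, mem_iUnion, mem_inter_iff, mem_ofPred_eq]
    exact le_stepUpVolume_iff hα hc (measurableSet_pValueLevelSet hp s)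
  rw [hset]
  refine .iInter fun n => .iUnion fun q => 
    (MeasurableSet.const _).inter
    (measurableSet_le measurable_const ?_)
  exact (measurable_measure_prodMk_left
    (measurableSet_pValueLevelSet_uncurry hp measurable_const)).ennreal_toReal

lemma measurableSet_linearStepUp_uncurry (hα : 0 < α) (hp : Measurable (Function.uncurry p)) :
    MeasurableSet {x : S × ℝ | x.2 ∈ linearStepUp α (p x.1)} :=
  measurableSet_pValueLevelSet_uncurry hp (measurable_stepUpVolume hα hp)

lemma measurable_falseDiscoveryProportion (hα : 0 < α) (hp : Measurable (Function.uncurry p))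
    {f : ℝ → ℝ} (hf : MeasurableSet {t | t ∈ Icc 0 1 ∧ f t ≤ 0}) :
    Measurable fun s => falseDiscoveryProportion f (linearStepUp α (p s)) := by
  have hnull : ∀ s, {t | t ∈ linearStepUp α (p s) ∧ f t ≤ 0} =
      Prod.mk s ⁻¹' ({x : S × ℝ | x.2 ∈ linearStepUp α (p x.1)} ∩
        Prod.snd ⁻¹' {t | t ∈ Icc 0 1 ∧ f t ≤ 0}) := fun s => by
    ext t
    exact ⟨fun ht => ⟨ht.1, ht.1.1, ht.2⟩, fun ht => ⟨ht.1, ht.2.2⟩⟩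
  simp only [falseDiscoveryProportion, volume_real_linearStepUp hα.le, hnull]
  have hr := measurable_stepUpVolume hα hp
  refine Measurable.ite (measurableSet_lt measurable_const hr) (.div ?_ hr) measurable_const
  exact (measurable_measure_prodMk_left ((measurableSet_linearStepUp_uncurry hα hp).inter
    (measurable_snd hf))).ennreal_toReal

end Measurability

lemma falseDiscoveryProportion_nonneg (f : ℝ → ℝ) (R : Set ℝ) :
    0 ≤ falseDiscoveryProportion f R := by
  unfold falseDiscoveryProportion
  split_ifs <;> positivity

lemma falseDiscoveryProportion_le_one (f : ℝ → ℝ) (R : Set ℝ) :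
    falseDiscoveryProportion f R ≤ 1 := by
  unfold falseDiscoveryProportion
  split_ifs with h
  · refine div_le_one_of_le₀ (measureReal_mono (fun t ht => ht.1) ?_) h.le
    exact (ENNReal.toReal_pos_iff.1 h).2.ne
  · exact zero_le_one

open scoped ENNReal in
/-- The false discovery proportion is an integral over the true nulls: a rejected true null `t`
contributes `1 / r̂`. If `r̂ = 0` both sides vanish, thanks to `0⁻¹ = 0`. -/
lemma ofReal_falseDiscoveryProportion_linearStepUp {α : ℝ} (hα : 0 ≤ α) {p : ℝ → ℝ} {f : ℝ → ℝ}
    (hR : MeasurableSet (linearStepUp α p)) :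
    ENNReal.ofReal (falseDiscoveryProportion f (linearStepUp α p)) =
      ∫⁻ t in {t | t ∈ Icc 0 1 ∧ f t ≤ 0},
        (linearStepUp α p).indicator (fun _ => ENNReal.ofReal (stepUpVolume α p)⁻¹) t := by
  rw [lintegral_indicator_const hR, Measure.restrict_apply hR]
  have hset : {t | t ∈ linearStepUp α p ∧ f t ≤ 0} =
      linearStepUp α p ∩ {t | t ∈ Icc 0 1 ∧ f t ≤ 0} := by
    ext t
    exact ⟨fun ht => ⟨ht.1, ht.1.1, ht.2⟩, fun ht => ⟨ht.1, ht.2.2⟩⟩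
  have hfin : volume (linearStepUp α p ∩ {t | t ∈ Icc 0 1 ∧ f t ≤ 0}) ≠ ⊤ :=
    measure_ne_top_of_subset inter_subset_left (volume_pValueLevelSet_ne_top _ _ _)
  rw [falseDiscoveryProportion, volume_real_linearStepUp hα, hset]
  split_ifs with h
  · rw [div_eq_inv_mul, ENNReal.ofReal_mul (inv_nonneg.2 h.le), Measure.real,
      ENNReal.ofReal_toReal hfin]
  · simp [le_antisymm (not_lt.1 h) (stepUpVolume_nonneg hα p)]

/-! ### False discovery rate for positively correlated Gaussian noise -/

lemma gaussianUpperTail_antitone : Antitone gaussianUpperTail := fun _ _ h =>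
  measureReal_mono (Ici_subset_Ici.2 h)

/-- The Gaussian p-value of a true null is stochastically at least uniform. Writing the event as
an upper set, a compact subset is contained in the half-line starting at its least point. -/
lemma gaussianReal_gaussianUpperTail_le (m : ℝ) (hm : m ≤ 0) {u : ℝ} :
    gaussianReal 0 1 {y | gaussianUpperTail (m + y) ≤ u} ≤ ENNReal.ofReal u := by
  have hmeas : MeasurableSet {y | gaussianUpperTail (m + y) ≤ u} :=
    measurableSet_le (gaussianUpperTail_antitone.measurable.comp (measurable_const_add m))
      measurable_const
  rw [hmeas.measure_eq_iSup_isCompact]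
  refine iSup₂_le fun K hKsub => iSup_le fun hK => ?_
  rcases K.eq_empty_or_nonempty with rfl | hne
  · simp
  obtain ⟨a, haK, hamin⟩ := hK.exists_isLeast hne
  have hau : gaussianUpperTail a ≤ u :=
    (gaussianUpperTail_antitone (add_le_of_nonpos_left hm)).trans (hKsub haK)
  calc gaussianReal 0 1 K ≤ gaussianReal 0 1 (Ici a) := measure_mono fun y hy => hamin hy
    _ = ENNReal.ofReal (gaussianUpperTail a) := (ofReal_measureReal).symm
    _ ≤ ENNReal.ofReal u := ENNReal.ofReal_le_ofReal hau

open scoped ENNReal in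
/-- The self-consistency bound: if the p-value `q` is antitone and the rejection volume `h` is
monotone in the same real variable, and `q` is stochastically at least uniform, then
`𝔼[𝟙{q ≤ α h} / h] ≤ α`. On the event, `α h` dominates the supremum of `q` over the event. -/
lemma lintegral_indicator_ofReal_inv_le {ν : Measure ℝ} {q h : ℝ → ℝ} (hq : Antitone q)
    (hh : Monotone h) (hq0 : ∀ y, 0 ≤ q y)
    (hunif : ∀ u, ν {y | q y ≤ u} ≤ ENNReal.ofReal u) {α : ℝ} (hα : 0 < α) :
    ∫⁻ y, {y | q y ≤ α * h y}.indicator (fun y => ENNReal.ofReal (h y)⁻¹) y ∂ν ≤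
      ENNReal.ofReal α := by
  set A : Set ℝ := {y | q y ≤ α * h y} with hA
  rcases A.eq_empty_or_nonempty with he | hne
  · simp [he]
  have hcross : ∀ y ∈ A, ∀ y' ∈ A, q y' ≤ α * h y := fun y hy y' hy' => by
    rcases le_total y' y with hle | hle
    · exact (show q y' ≤ α * h y' from hy').trans (mul_le_mul_of_nonneg_left (hh hle) hα.le)
    · exact (hq hle).trans hy
  obtain ⟨y₀, hy₀⟩ := hne
  have hbdd : BddAbove (q '' A) :=
    ⟨α * h y₀, by rintro _ ⟨y', hy', rfl⟩; exact hcross y₀ hy₀ y' hy'⟩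
  set u := sSup (q '' A)
  have hqu : ∀ y ∈ A, q y ≤ u := fun y hy => le_csSup hbdd (mem_image_of_mem q hy)
  have huh : ∀ y ∈ A, u ≤ α * h y := fun y hy =>
    csSup_le ⟨_, mem_image_of_mem q hy₀⟩ (by rintro _ ⟨y', hy', rfl⟩; exact hcross y hy y' hy')
  have hu0 : 0 ≤ u := (hq0 y₀).trans (hqu y₀ hy₀)
  have hνA : ν A ≤ ENNReal.ofReal u := (measure_mono hqu).trans (hunif u)
  have hbound : ∀ c : ℝ≥0∞, (∀ y ∈ A, ENNReal.ofReal (h y)⁻¹ ≤ c) →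
      ∫⁻ y, A.indicator (fun y => ENNReal.ofReal (h y)⁻¹) y ∂ν ≤ c * ENNReal.ofReal u := by
    intro c hc
    calc ∫⁻ y, A.indicator (fun y => ENNReal.ofReal (h y)⁻¹) y ∂ν
        ≤ ∫⁻ y, A.indicator (fun _ => c) y ∂ν :=
          lintegral_mono fun y => indicator_le_indicator' fun hy => hc y hy
      _ ≤ c * ν A := lintegral_indicator_const_le A c
      _ ≤ c * ENNReal.ofReal u := by gcongr
  -- If `u = 0` the event is null, so an infinite bound on the integrand is harmless.
  rcases hu0.eq_or_lt with hu | hu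
  · refine (hbound ⊤ fun _ _ => le_top).trans ?_
    simp [← hu]
  · refine (hbound (ENNReal.ofReal (α / u)) fun y hy => ENNReal.ofReal_le_ofReal ?_).trans ?_
    · rw [← inv_div]
      exact inv_anti₀ (by positivity) ((div_le_iff₀' hα).2 (huh y hy))
    · rw [← ENNReal.ofReal_mul (by positivity), div_mul_cancel₀ _ hu.ne']

/-- Continuous paths `ℝ → ℝ`, with the σ-algebra generated by the evaluations. -/
abbrev ContinuousPath : Type := {w : ℝ → ℝ // Continuous w}

lemma measurable_eval_continuousPath :
    Measurable fun x : ContinuousPath × ℝ => x.1.1 x.2 := by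
  have h : Measurable (Function.uncurry fun (t : ℝ) (w : ContinuousPath) => w.1 t) :=
    measurable_uncurry_of_continuous_of_measurable (fun w => w.2)
      (fun t => (measurable_pi_apply t).comp measurable_subtype_coe)
  exact h.comp measurable_swap

section Null

variable {Ω : Type*} [MeasurableSpace Ω] {P : Measure Ω} [IsProbabilityMeasure P]

open scoped ENNReal in
/-- Control of a single true null `t`. The test statistics are `m s + c s * N + W s`, where `N` is
the standard Gaussian noise at `t`, the process `W` is independent of `N`, and `c ≥ 0`. Given `W`,
increasing `N` increases all test statistics, hence the rejection volume, and the self-consistency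
bound applies conditionally on `W`. -/
lemma lintegral_rejection_le_of_decomposition {N : Ω → ℝ} {W : ℝ → Ω → ℝ} {m c : ℝ → ℝ}
    (hN : Measurable N) (hlaw : P.map N = gaussianReal 0 1) (hW : ∀ s, Measurable (W s))
    (hWc : ∀ ω, Continuous fun s => W s ω) (hind : IndepFun N (fun ω s => W s ω) P)
    (hm : Measurable m) (hc : Measurable c) (hc0 : ∀ s, 0 ≤ c s) {t : ℝ} (hmt : m t ≤ 0)
    {α : ℝ} (hα : 0 < α) :
    ∫⁻ ω, {ω | gaussianUpperTail (m t + N ω) ≤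
        α * stepUpVolume α (fun s => gaussianUpperTail (m s + c s * N ω + W s ω))}.indicator
      (fun ω => ENNReal.ofReal
        (stepUpVolume α (fun s => gaussianUpperTail (m s + c s * N ω + W s ω)))⁻¹) ω ∂P ≤
      ENNReal.ofReal α := by
  let V : Ω → ContinuousPath := fun ω => ⟨fun s => W s ω, hWc ω⟩
  have hV : Measurable V := (measurable_pi_lambda _ hW).subtype_mk
  have := Measure.isProbabilityMeasure_map (μ := P) hV.aemeasurable
  have hindV : IndepFun N V P := by
    rw [IndepFun_iff_Indep] at hind ⊢
    convert! hind using 1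
    exact MeasurableSpace.comap_comp
  let r : ℝ × ContinuousPath → ℝ := fun x =>
    stepUpVolume α (fun s => gaussianUpperTail (m s + c s * x.1 + x.2.1 s))
  have hr : Measurable r := by
    refine measurable_stepUpVolume hα ?_
    refine gaussianUpperTail_antitone.measurable.comp (.add (.add (hm.comp measurable_snd)
      (.mul (hc.comp measurable_snd) (measurable_fst.comp measurable_fst))) ?_)
    exact measurable_eval_continuousPath.comp
      ((measurable_snd.comp measurable_fst).prodMk measurable_snd)
  let F : ℝ × ContinuousPath → ℝ≥0∞ := {x | gaussianUpperTail (m t + x.1) ≤ α * r x}.indicator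
    (fun x => ENNReal.ofReal (r x)⁻¹)
  have hF : Measurable F := by
    refine hr.inv.ennreal_ofReal.indicator (measurableSet_le ?_ (hr.const_mul α))
    exact gaussianUpperTail_antitone.measurable.comp (measurable_fst.const_add _)
  calc _ = ∫⁻ ω, F (N ω, V ω) ∂P := rfl
    _ = ∫⁻ x, F x ∂(P.map fun ω => (N ω, V ω)) := (lintegral_map hF (hN.prodMk hV)).symm
    _ = ∫⁻ x, F x ∂((gaussianReal 0 1).prod (P.map V)) := by
        rw [hindV.map_prod_eq_prod_map_map hN.aemeasurable hV.aemeasurable, hlaw]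
    _ = ∫⁻ w, ∫⁻ y, F (y, w) ∂(gaussianReal 0 1) ∂(P.map V) :=
        lintegral_prod_symm' F hF
    _ ≤ ∫⁻ w, ENNReal.ofReal α ∂(P.map V) := lintegral_mono fun w => ?_
    _ = ENNReal.ofReal α := by
        simp
  refine lintegral_indicator_ofReal_inv_le (ν := gaussianReal 0 1)
    (q := fun y => gaussianUpperTail (m t + y)) (h := fun y => r (y, w))
    (fun y y' h => gaussianUpperTail_antitone (by gcongr)) (fun y y' h => ?_)
    (fun _ => measureReal_nonneg)
    (fun u => gaussianReal_gaussianUpperTail_le _ hmt) hα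
  refine stepUpVolume_anti hα.le fun s _ => gaussianUpperTail_antitone ?_
  have := mul_le_mul_of_nonneg_left h (hc0 s)
  dsimp only
  linarith

open scoped ENNReal in
/-- The step-up procedure applied to `m + ξ` controls the false discovery rate, for a
centred Gaussian process `ξ` with continuous paths, unit variances and nonnegative continuous
covariances. -/
theorem lintegral_falseDiscoveryProportion_le {ξ : ℝ → Ω → ℝ} (hξ : ∀ s, Measurable (ξ s))
    (hξc : ∀ ω, Continuous fun s => ξ s ω) (hG : IsGaussianProcess ξ P)
    (hlaw : ∀ s, P.map (ξ s) = gaussianReal 0 1) (hcov0 : ∀ s t, 0 ≤ cov[ξ s, ξ t; P])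
    (hcov : ∀ t, Continuous fun s => cov[ξ s, ξ t; P]) {m : ℝ → ℝ} (hm : Measurable m)
    {f : ℝ → ℝ} (hnull : ∀ t ∈ Icc (0 : ℝ) 1, f t ≤ 0 → m t ≤ 0) {α : ℝ} (hα : 0 < α) :
    ∫⁻ ω, ENNReal.ofReal (falseDiscoveryProportion f
      (linearStepUp α fun t => gaussianUpperTail (m t + ξ t ω))) ∂P ≤ ENNReal.ofReal α := by
  have hL2 : ∀ s, MemLp (ξ s) 2 P := fun s => (hG.hasGaussianLaw_eval s).memLp_two
  have hvar : ∀ t, cov[ξ t, ξ t; P] = 1 := fun t => by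
    rw [covariance_self (hξ t).aemeasurable, ← variance_id_map (hξ t).aemeasurable, hlaw t]
    simp
  let p : Ω → ℝ → ℝ := fun ω t => gaussianUpperTail (m t + ξ t ω)
  have hp : Measurable (Function.uncurry p) := by
    refine gaussianUpperTail_antitone.measurable.comp (.add (hm.comp measurable_snd) ?_)
    exact (measurable_uncurry_of_continuous_of_measurable hξc hξ).comp measurable_swap
  -- The contribution of a single true null.
  have hsingle : ∀ t ∈ Icc (0 : ℝ) 1, f t ≤ 0 → ∫⁻ ω, (linearStepUp α (p ω)).indicator
      (fun _ => ENNReal.ofReal (stepUpVolume α (p ω))⁻¹) t ∂P ≤ ENNReal.ofReal α := by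
    intro t ht hft
    let c : ℝ → ℝ := fun s => cov[ξ s, ξ t; P]
    let W : ℝ → Ω → ℝ := fun s ω => ξ s ω - c s * ξ t ω
    have hW : ∀ s, Measurable (W s) := fun s => (hξ s).sub ((hξ t).const_mul _)
    -- `W` and `ξ t` are jointly Gaussian and uncorrelated, since `c` is the regression coefficient.
    have hind : IndepFun (fun ω (_ : Unit) => ξ t ω) (fun ω s => W s ω) P := by
      refine IsGaussianProcess.indepFun_of_covariance_eq_zero (X := fun _ : Unit => ξ t) ?_
        (fun _ => (hξ t).aemeasurable) (fun s => (hW s).aemeasurable) fun _ s => ?_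
      · classical
        refine hG.of_isGaussianProcess ?_
        rintro (_ | s)
        · exact ⟨{t}, { toFun x := x ⟨t, by simp⟩
                        map_add' x y := by simp
                        map_smul' a x := by simp }, by simp⟩
        · exact ⟨{s, t}, { toFun x := x ⟨s, by simp⟩ - c s * x ⟨t, by simp⟩
                           map_add' x y := by simp; ring
                           map_smul' a x := by simp; ring }, by simp [W]⟩
      · rw [covariance_fun_sub_right (hL2 t) (hL2 s) ((hL2 t).const_mul _),
          covariance_const_mul_right, hvar, covariance_comm]
        simp [c]
    have hbound := lintegral_rejection_le_of_decomposition (P := P) (N := ξ t) (W := W) (m := m)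
      (c := c) (hξ t) (hlaw t) hW
      (fun ω => (hξc ω).sub ((hcov t).mul continuous_const))
      (hind.comp (measurable_pi_apply ()) measurable_id) hm (hcov t).measurable
      (fun s => hcov0 s t) (hnull t ht hft) hα
    have hdecomp : ∀ ω, (fun s => gaussianUpperTail (m s + c s * ξ t ω + W s ω)) = p ω :=
      fun ω => by
        funext s
        simp only [p, W]
        congr 1
        ring
    simp only [hdecomp] at hbound
    refine le_trans (le_of_eq (lintegral_congr fun ω => ?_)) hbound
    have hiff : t ∈ linearStepUp α (p ω) ↔
        gaussianUpperTail (m t + ξ t ω) ≤ α * stepUpVolume α (p ω) :=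
      and_iff_right ht
    classical
    simp only [indicator_apply, mem_ofPred_eq]
    exact if_congr hiff rfl rfl
  have hR := measurableSet_linearStepUp_uncurry hα hp
  let H : Set ℝ := {t | t ∈ Icc 0 1 ∧ f t ≤ 0}
  calc _ = ∫⁻ ω, (∫⁻ t in H, (linearStepUp α (p ω)).indicator
        (fun _ => ENNReal.ofReal (stepUpVolume α (p ω))⁻¹) t) ∂P :=
        lintegral_congr fun ω => ofReal_falseDiscoveryProportion_linearStepUp hα.le
          (measurable_prodMk_left (x := ω) hR)
    _ = ∫⁻ t in H, (∫⁻ ω, (linearStepUp α (p ω)).indicator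
        (fun _ => ENNReal.ofReal (stepUpVolume α (p ω))⁻¹) t ∂P) := by
        refine lintegral_lintegral_swap (Measurable.aemeasurable ?_)
        exact (((measurable_stepUpVolume hα hp).inv.ennreal_ofReal).comp measurable_fst).indicator hR
    _ ≤ ∫⁻ t in H, ENNReal.ofReal α :=
        setLIntegral_mono measurable_const fun t ht => hsingle t ht.1 ht.2
    _ = ENNReal.ofReal α * volume H := setLIntegral_const _ _
    _ ≤ ENNReal.ofReal α * volume (Icc (0 : ℝ) 1) := by
        gcongr
        exact fun t ht => ht.1
    _ = ENNReal.ofReal α := by simp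

end Null

/-! ### Measurable continuous modifications -/

open Filter Topology in
/-- A process with almost surely continuous paths, each marginal being almost everywhere
measurable, agrees almost surely, at all times simultaneously, with a process all of whose
paths are continuous and all of whose marginals are measurable. -/
lemma exists_measurable_continuous_modification {Ω T : Type*} [MeasurableSpace Ω]
    [TopologicalSpace T] [SecondCountableTopology T] {P : Measure Ω} {X : T → Ω → ℝ}
    (hX : ∀ t, AEMeasurable (X t) P) (hXc : ∀ᵐ ω ∂P, Continuous fun t => X t ω) :
    ∃ X' : T → Ω → ℝ, (∀ t, Measurable (X' t)) ∧ (∀ ω, Continuous fun t => X' t ω) ∧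
      ∀ᵐ ω ∂P, ∀ t, X t ω = X' t ω := by
  classical
  obtain ⟨D, hDc, hD⟩ := TopologicalSpace.exists_countable_dense T
  have hae : ∀ᵐ ω ∂P, (Continuous fun t => X t ω) ∧ ∀ t ∈ D, X t ω = (hX t).mk (X t) ω :=
    hXc.and ((ae_ball_iff hDc).2 fun t _ => (hX t).ae_eq_mk)
  obtain ⟨G, hGsub, hGmeas, hGae⟩ := exists_measurable_superset_of_null (ae_iff.1 hae)
  have hgood : ∀ ω, ω ∉ G → (Continuous fun t => X t ω) ∧
      ∀ t ∈ D, X t ω = (hX t).mk (X t) ω := fun ω hω => by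
    by_contra h
    exact hω (hGsub h)
  refine ⟨fun t => Gᶜ.indicator (X t), fun t => ?_, fun ω => ?_, ?_⟩
  · obtain ⟨u, huD, hu⟩ := mem_closure_iff_seq_limit.1 (hD t)
    refine measurable_of_tendsto_metrizable (f := fun n => Gᶜ.indicator ((hX (u n)).mk (X (u n))))
      (fun n => (hX (u n)).measurable_mk.indicator hGmeas.compl) (tendsto_pi_nhds.2 fun ω => ?_)
    by_cases hω : ω ∈ G
    · simp [hω]
    · simp only [indicator_of_mem (show ω ∈ Gᶜ from hω), ← (hgood ω hω).2 _ (huD _)]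
      exact ((hgood ω hω).1.tendsto t).comp hu
  · by_cases hω : ω ∈ G
    · simpa [hω] using! continuous_const
    · simpa [hω] using! (hgood ω hω).1
  · filter_upwards [measure_eq_zero_iff_ae_notMem.1 hGae] with ω hω t
    simp [hω]

lemma covariance_congr_ae {Ω : Type*} [MeasurableSpace Ω] {P : Measure Ω} {X X' Y Y' : Ω → ℝ}
    (hX : X =ᵐ[P] X') (hY : Y =ᵐ[P] Y') : cov[X, Y; P] = cov[X', Y'; P] := by
  simp only [covariance, integral_congr_ae hX, integral_congr_ae hY]
  refine integral_congr_ae ?_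
  filter_upwards [hX, hY] with ω hω hω'
  rw [hω, hω']

/-! ### Window increments of a Wiener process -/

section Wiener

variable {Ω : Type*} [MeasurableSpace Ω] {P : Measure Ω} {a b : ℝ} {B : ℝ → Ω → ℝ}

namespace IsWienerProcessOn

lemma hasLaw_eval (hB : IsWienerProcessOn a b B P) {t : ℝ} (ht : t ∈ Icc a b) :
    HasLaw (B t) (gaussianReal 0 (t - a).toNNReal) P := by
  refine (hB.law_increment a t le_rfl ht.1 ht.2).congr ?_
  filter_upwards [hB.start_eq_zero] with ω hω
  simp [hω]

lemma isGaussianProcess (hB : IsWienerProcessOn a b B P) (hab : a < b) :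
    IsGaussianProcess (fun t : Icc a b => B t) P := by
  have : Fact (a ≤ b) := ⟨hab.le⟩
  refine HasIndepIncrements.isGaussianProcess (fun t => ?_) hB.start_eq_zero hB.indep_increments
  exact (hB.hasLaw_eval t.2).hasGaussianLaw

lemma memLp_two (hB : IsWienerProcessOn a b B P) (hab : a < b) {t : ℝ} (ht : t ∈ Icc a b) :
    MemLp (B t) 2 P :=
  ((hB.isGaussianProcess hab).hasGaussianLaw_eval ⟨t, ht⟩).memLp_two

lemma covariance_eval (hB : IsWienerProcessOn a b B P) (hab : a < b) {s t : ℝ}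
    (hs : s ∈ Icc a b) (ht : t ∈ Icc a b) : cov[B s, B t; P] = min s t - a := by
  have := (hB.isGaussianProcess hab).isProbabilityMeasure
  wlog hst : s ≤ t generalizing s t
  · rw [covariance_comm, min_comm]
    exact this ht hs (le_of_not_ge hst)
  have hind := hB.indep_increments.indepFun_eval_sub (r := ⟨a, left_mem_Icc.2 hab.le⟩)
    (s := ⟨s, hs⟩) (t := ⟨t, ht⟩) hs.1 hst hB.start_eq_zero
  have hcov := hind.covariance_eq_zero (hB.memLp_two hab hs)
    ((hB.memLp_two hab ht).sub (hB.memLp_two hab hs))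
  have hvar : Var[B s; P] = s - a := by
    rw [(hB.hasLaw_eval hs).variance_eq, variance_id_gaussianReal]
    exact Real.coe_toNNReal _ (sub_nonneg.2 hs.1)
  rw [covariance_sub_right (hB.memLp_two hab hs) (hB.memLp_two hab ht) (hB.memLp_two hab hs),
    covariance_self (hB.hasLaw_eval hs).aemeasurable, hvar, sub_eq_zero] at hcov
  rw [hcov, min_eq_left hst]

lemma covariance_increments (hB : IsWienerProcessOn a b B P) (hab : a < b) {s s' t t' : ℝ}
    (hs : s ∈ Icc a b) (hs' : s' ∈ Icc a b) (ht : t ∈ Icc a b) (ht' : t' ∈ Icc a b) :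
    cov[fun ω => B s' ω - B s ω, fun ω => B t' ω - B t ω; P] =
      min s' t' - min s' t - min s t' + min s t := by
  have := (hB.isGaussianProcess hab).isProbabilityMeasure
  rw [covariance_fun_sub_fun_sub (hB.memLp_two hab hs') (hB.memLp_two hab hs)
    (hB.memLp_two hab ht') (hB.memLp_two hab ht), hB.covariance_eval hab hs' ht',
    hB.covariance_eval hab hs' ht, hB.covariance_eval hab hs ht', hB.covariance_eval hab hs ht]
  ring

end IsWienerProcessOn

/-- The normalised noise increment over the window of radius `η` around `t`. The centre is
clipped to `[0, 1]`, so that the process is indexed by all of `ℝ` while only using values of `B`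
on `[-1, 2]`. -/
noncomputable def windowNoise (η : ℝ) (B : ℝ → Ω → ℝ) (t : ℝ) (ω : Ω) : ℝ :=
  (Real.sqrt (2 * η))⁻¹ * (B (projIcc 0 1 zero_le_one t + η) ω -
    B (projIcc 0 1 zero_le_one t - η) ω)

variable {η : ℝ}

lemma add_mem_Icc_of_mem_unitInterval (hη : 0 < η) (hη1 : η ≤ 1) {t : ℝ} (ht : t ∈ Icc (0 : ℝ) 1) :
    t + η ∈ Icc (-1 : ℝ) 2 := ⟨by linarith [ht.1], by linarith [ht.2]⟩

lemma sub_mem_Icc_of_mem_unitInterval (hη : 0 < η) (hη1 : η ≤ 1) {t : ℝ} (ht : t ∈ Icc (0 : ℝ) 1) :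
    t - η ∈ Icc (-1 : ℝ) 2 := ⟨by linarith [ht.1], by linarith [ht.2]⟩

lemma isGaussianProcess_windowNoise (hB : IsWienerProcessOn (-1) 2 B P) (hη : 0 < η)
    (hη1 : η ≤ 1) : IsGaussianProcess (windowNoise η B) P := by
  classical
  have hG := hB.isGaussianProcess (by norm_num)
  refine hG.of_isGaussianProcess fun t => ?_
  have ht := (projIcc (0 : ℝ) 1 zero_le_one t).2
  let u : Icc (-1 : ℝ) 2 := ⟨_, add_mem_Icc_of_mem_unitInterval hη hη1 ht⟩
  let v : Icc (-1 : ℝ) 2 := ⟨_, sub_mem_Icc_of_mem_unitInterval hη hη1 ht⟩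
  exact ⟨{u, v}, { toFun x := (Real.sqrt (2 * η))⁻¹ * (x ⟨u, by simp⟩ - x ⟨v, by simp⟩)
                   map_add' x y := by simp; ring
                   map_smul' c x := by simp; ring }, fun ω => by simp [windowNoise, u, v]⟩

lemma hasLaw_windowNoise (hB : IsWienerProcessOn (-1) 2 B P) (hη : 0 < η) (hη1 : η ≤ 1) (t : ℝ) :
    HasLaw (windowNoise η B t) (gaussianReal 0 1) P := by
  have ht := (projIcc (0 : ℝ) 1 zero_le_one t).2
  have h := gaussianReal_const_mul (hB.law_increment _ _
    (sub_mem_Icc_of_mem_unitInterval hη hη1 ht).1 (by linarith)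
    (add_mem_Icc_of_mem_unitInterval hη hη1 ht).2) (Real.sqrt (2 * η))⁻¹
  convert! h using 2
  · simp
  · ext
    rw [NNReal.coe_one, NNReal.coe_mul, NNReal.coe_mk, Real.coe_toNNReal _ (by linarith), inv_pow,
      Real.sq_sqrt (by positivity)]
    field_simp
    ring

/-- The covariance of two window increments is the relative overlap of the windows. -/
lemma covariance_windowNoise (hB : IsWienerProcessOn (-1) 2 B P) (hη : 0 < η) (hη1 : η ≤ 1)
    (s t : ℝ) : cov[windowNoise η B s, windowNoise η B t; P] =
      max 0 (1 - |(projIcc (0 : ℝ) 1 zero_le_one s : ℝ) - projIcc (0 : ℝ) 1 zero_le_one t| /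
        (2 * η)) := by
  have hs := (projIcc (0 : ℝ) 1 zero_le_one s).2
  have ht := (projIcc (0 : ℝ) 1 zero_le_one t).2
  unfold windowNoise
  rw [covariance_const_mul_left, covariance_const_mul_right,
    hB.covariance_increments (by norm_num) (sub_mem_Icc_of_mem_unitInterval hη hη1 hs)
    (add_mem_Icc_of_mem_unitInterval hη hη1 hs) (sub_mem_Icc_of_mem_unitInterval hη hη1 ht)
    (add_mem_Icc_of_mem_unitInterval hη hη1 ht)]
  generalize (projIcc (0 : ℝ) 1 zero_le_one s : ℝ) = x
  generalize (projIcc (0 : ℝ) 1 zero_le_one t : ℝ) = y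
  have hoverlap : min (x + η) (y + η) - min (x + η) (y - η) - min (x - η) (y + η) +
      min (x - η) (y - η) = max 0 (2 * η - |x - y|) := by
    grind
  rw [hoverlap, ← mul_assoc, ← mul_inv, Real.mul_self_sqrt (by positivity),
    mul_max_of_nonneg _ _ (by positivity), mul_zero]
  congr 1
  field_simp

end Wiener

/-! ### Mean of the test statistic -/

section Mean

variable {L : NNReal} {f : ℝ → ℝ} {η : ℝ}

/-- The mean of the test statistic, as a function of the true signal. The centre is clipped to
`[0, 1]` as in `windowNoise`. -/
noncomputable def windowMean (L η : ℝ) (f : ℝ → ℝ) (t : ℝ) : ℝ :=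
  (Real.sqrt (2 * η))⁻¹ * ((∫ s in (-1 : ℝ)..(projIcc 0 1 zero_le_one t + η), f s) -
    (∫ s in (-1 : ℝ)..(projIcc 0 1 zero_le_one t - η), f s) - L * η ^ 2)

lemma testStatistic_eq_windowMean_add_windowNoise {Ω : Type*} (B : ℝ → Ω → ℝ) (L : ℝ) {t : ℝ}
    (ht : t ∈ Icc (0 : ℝ) 1) (ω : Ω) :
    testStatistic L η (signalPlusNoise f B) t ω = windowMean L η f t + windowNoise η B t ω := by
  simp only [testStatistic, signalPlusNoise, windowMean, windowNoise, projIcc_of_mem _ ht]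
  ring

lemma continuous_windowMean (hf : ContinuousOn f (Icc (-1) 2)) (L : ℝ) (hη : 0 < η)
    (hη1 : η ≤ 1) : Continuous (windowMean L η f) := by
  have hprim : ContinuousOn (fun x => ∫ s in (-1 : ℝ)..x, f s) (Icc (-1) 2) := by
    rw [← uIcc_of_le (by norm_num : (-1 : ℝ) ≤ 2)] at hf ⊢
    exact intervalIntegral.continuousOn_primitive_interval hf.integrableOn_uIcc
  have hproj : Continuous fun t : ℝ => (projIcc (0 : ℝ) 1 zero_le_one t : ℝ) :=
    continuous_subtype_val.comp continuous_projIcc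
  refine continuous_const.mul (.sub (.sub ?_ ?_) continuous_const)
  · exact hprim.comp_continuous (hproj.add_const η) fun t =>
      add_mem_Icc_of_mem_unitInterval hη hη1 (projIcc (0 : ℝ) 1 zero_le_one t).2
  · exact hprim.comp_continuous (hproj.sub continuous_const) fun t =>
      sub_mem_Icc_of_mem_unitInterval hη hη1 (projIcc (0 : ℝ) 1 zero_le_one t).2

/-- At a true null the Lipschitz bound `f s ≤ L |s - t|`, integrated over the window, is
compensated by the bias correction `L η²`. -/
lemma windowMean_nonpos (hf : LipschitzOnWith L f (Icc (-1) 2)) (hη : 0 < η) (hη1 : η ≤ 1)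
    {t : ℝ} (ht : t ∈ Icc (0 : ℝ) 1) (hft : f t ≤ 0) : windowMean L η f t ≤ 0 := by
  have hplus := add_mem_Icc_of_mem_unitInterval hη hη1 ht
  have hminus := sub_mem_Icc_of_mem_unitInterval hη hη1 ht
  have hint : ∀ x y, x ∈ Icc (-1 : ℝ) 2 → y ∈ Icc (-1 : ℝ) 2 →
      IntervalIntegrable f volume x y := fun x y hx hy =>
    (hf.continuousOn.mono (uIcc_subset_Icc hx hy)).intervalIntegrable
  have hleft : (-1 : ℝ) ∈ Icc (-1 : ℝ) 2 := by norm_num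
  have htI : t ∈ Icc (-1 : ℝ) 2 := ⟨by linarith [ht.1], by linarith [ht.2]⟩
  have hpt : ∀ s ∈ Icc (-1 : ℝ) 2, f s ≤ L * |s - t| := fun s hs => by
    have := (le_abs_self _).trans (hf.dist_le_mul s hs t htI)
    rw [Real.dist_eq] at this
    linarith
  have hafter : ∫ s in t..(t + η), f s ≤ L * η ^ 2 / 2 := by
    calc ∫ s in t..(t + η), f s ≤ ∫ s in t..(t + η), L * (s - t) := by
          refine intervalIntegral.integral_mono_on (by linarith) (hint _ _ htI hplus)
            (Continuous.intervalIntegrable (by fun_prop) _ _) fun s hs => ?_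
          have := hpt s ⟨htI.1.trans hs.1, hs.2.trans hplus.2⟩
          rwa [abs_of_nonneg (sub_nonneg.2 hs.1)] at this
      _ = L * η ^ 2 / 2 := by
          rw [intervalIntegral.integral_const_mul,
            intervalIntegral.integral_comp_sub_right (fun x => x) t, integral_id]
          ring
  have hbefore : ∫ s in (t - η)..t, f s ≤ L * η ^ 2 / 2 := by
    calc ∫ s in (t - η)..t, f s ≤ ∫ s in (t - η)..t, L * (t - s) := by
          refine intervalIntegral.integral_mono_on (by linarith) (hint _ _ hminus htI)
            (Continuous.intervalIntegrable (by fun_prop) _ _) fun s hs => ?_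
          have := hpt s ⟨hminus.1.trans hs.1, hs.2.trans htI.2⟩
          rwa [abs_sub_comm, abs_of_nonneg (sub_nonneg.2 hs.2)] at this
      _ = L * η ^ 2 / 2 := by
          rw [intervalIntegral.integral_const_mul,
            intervalIntegral.integral_comp_sub_left (fun x => x) t, integral_id]
          ring
  simp only [windowMean, projIcc_of_mem _ ht]
  rw [intervalIntegral.integral_interval_sub_left (hint _ _ hleft hplus) (hint _ _ hleft hminus),
    ← intervalIntegral.integral_add_adjacent_intervals (hint _ _ hminus htI) (hint _ _ htI hplus)]
  exact mul_nonpos_of_nonneg_of_nonpos (by positivity) (by linarith)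

end Mean

/-! ### False discovery rate of the procedure -/

theorem corollary4p3 {Ω : Type*} [MeasurableSpace Ω] (P : Measure Ω) [IsProbabilityMeasure P]
    (B : ℝ → Ω → ℝ) (hB : IsWienerProcessOn (-1) 2 B P)
    (L : NNReal) (hL : 0 < L) (f : ℝ → ℝ) (hf : LipschitzOnWith L f (Icc (-1) 2))
    (η : ℝ) (hη : 0 < η) (hη1 : η ≤ 1) (α : ℝ) (hα : 0 < α) (hα1 : α < 1)
    (Y : ℝ → Ω → ℝ) (hY : Y = testStatistic L η (signalPlusNoise f B))
    (p : Ω → ℝ → ℝ) (hp : p = fun ω t => gaussianUpperTail (Y t ω)) :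
    (∀ ω, IsGreatest (stepUpCandidates α (p ω)) (stepUpVolume α (p ω))) ∧
    Integrable (fun ω => falseDiscoveryProportion f (linearStepUp α (p ω))) P ∧
    ∫ ω, falseDiscoveryProportion f (linearStepUp α (p ω)) ∂P ≤ α := by
  refine ⟨fun ω => isGreatest_stepUpVolume hα.le _, ?_⟩
  have hG := isGaussianProcess_windowNoise hB hη hη1
  have hproj : Continuous fun t : ℝ => (projIcc (0 : ℝ) 1 zero_le_one t : ℝ) :=
    continuous_subtype_val.comp continuous_projIcc
  have hcont : ∀ᵐ ω ∂P, Continuous fun t => windowNoise η B t ω := by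
    filter_upwards [hB.continuous_paths] with ω hω
    refine continuous_const.mul (.sub ?_ ?_)
    · exact hω.comp_continuous (hproj.add_const η) fun t =>
        add_mem_Icc_of_mem_unitInterval hη hη1 (projIcc (0 : ℝ) 1 zero_le_one t).2
    · exact hω.comp_continuous (hproj.sub continuous_const) fun t =>
        sub_mem_Icc_of_mem_unitInterval hη hη1 (projIcc (0 : ℝ) 1 zero_le_one t).2
  obtain ⟨ξ, hξ, hξc, hξae⟩ := exists_measurable_continuous_modification hG.aemeasurable hcont
  have hξae' : ∀ t, windowNoise η B t =ᵐ[P] ξ t := fun t => hξae.mono fun ω hω => hω t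
  have hcov : ∀ s t, cov[ξ s, ξ t; P] =
      max 0 (1 - |(projIcc (0 : ℝ) 1 zero_le_one s : ℝ) - projIcc (0 : ℝ) 1 zero_le_one t| /
        (2 * η)) := fun s t => by
    rw [← covariance_windowNoise hB hη hη1, covariance_congr_ae (hξae' s) (hξae' t)]
  have hm := (continuous_windowMean hf.continuousOn L hη hη1).measurable
  have hH : MeasurableSet {t | t ∈ Icc 0 1 ∧ f t ≤ 0} := by
    have hcontf : ContinuousOn f (Icc 0 1) :=
      hf.continuousOn.mono (Icc_subset_Icc (by norm_num) (by norm_num))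
    exact (hcontf.preimage_isClosed_of_isClosed isClosed_Icc (isClosed_Iic (a := 0))).measurableSet
  let p' : Ω → ℝ → ℝ := fun ω t => gaussianUpperTail (windowMean L η f t + ξ t ω)
  have hp' : Measurable (Function.uncurry p') := by
    refine gaussianUpperTail_antitone.measurable.comp (.add (hm.comp measurable_snd) ?_)
    exact (measurable_uncurry_of_continuous_of_measurable hξc hξ).comp measurable_swap
  have hFDP : (fun ω => falseDiscoveryProportion f (linearStepUp α (p ω))) =ᵐ[P]
      fun ω => falseDiscoveryProportion f (linearStepUp α (p' ω)) := by
    filter_upwards [hξae] with ω hω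
    refine congrArg _ (linearStepUp_congr fun t ht => ?_)
    simp only [hp, hY, p', testStatistic_eq_windowMean_add_windowNoise B L ht, hω]
  have hmeas := measurable_falseDiscoveryProportion hα hp' hH
  have hbound := lintegral_falseDiscoveryProportion_le hξ hξc (hG.congr hξae')
    (fun t => ((hasLaw_windowNoise hB hη hη1 t).congr (hξae' t).symm).map_eq)
    (fun s t => by rw [hcov]; exact le_max_left _ _)
    (fun t => by simp only [hcov]; fun_prop) hm
    (fun t ht hft => windowMean_nonpos hf hη hη1 ht hft) hα
  constructor
  · refine Integrable.congr ?_ hFDP.symm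
    refine Integrable.of_bound hmeas.aestronglyMeasurable 1 (.of_forall fun ω => ?_)
    rw [Real.norm_of_nonneg (falseDiscoveryProportion_nonneg _ _)]
    exact falseDiscoveryProportion_le_one _ _
  · rw [integral_congr_ae hFDP, integral_eq_lintegral_of_nonneg_ae
      (.of_forall fun ω => falseDiscoveryProportion_nonneg _ _) hmeas.aestronglyMeasurable]
    exact ENNReal.toReal_le_of_le_ofReal hα.le hbound
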